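/- Let $N\ge 1$, let $F$ be a field and let $q,q_0,q_N,s,\zeta_0,\zeta_N,\kappa_0,\kappa_N\in F$ be nonzero (they may be specialized). Let $L=F(z_1,\dots,z_N)$, which contains the Laurent polynomials $F[z_1^{\pm1},\dots,z_N^{\pm1}]$, and let $(s_if)(\mathbf z)=f(s_i\mathbf z)$ for $f\in L$, where $s_0\mathbf z=(s^2z_1^{-1},z_2,\dots,z_N)$, $s_N\mathbf z=(z_1,\dots,z_{N-1},z_N^{-1})$, and $s_i$ exchanges $z_i$ and $z_{i+1}$ for $1\le i\le N-1$. Define operators on $L$ by $$\hat T_0=-q_0-q_0^{-1}\frac{(1-sq_0\zeta_0^{-1}z_1^{-1})(1+sq_0\zeta_0z_1^{-1})}{1-s^2z_1^{-2}}(s_0-1),\qquad \hat T_N=-q_N-q_N^{-1}\frac{(1+q_N\zeta_Nz_N)(1-q_N\zeta_N^{-1}z_N)}{1-z_N^2}(s_N-1),$$ $$\hat T_i=-q-q^{-1}\frac{1-q^2z_iz_{i+1}^{-1}}{1-z_iz_{i+1}^{-1}}(s_i-1)\quad(1\le i\le N-1),$$ and the Cherednik--Noumi operators $$\hat Y_i=\hat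 T_i\cdots\hat T_{N-1}\hat T_N\hat T_{N-1}\cdots\hat T_1\hat T_0\hat T_1^{-1}\cdots\hat T_{i-1}^{-1}\qquad(1\le i\le N).$$ Let $V$ have basis $(v_+,v_-)$, and on $V^{\otimes N}$ with basis $v_\epsilon$, $\epsilon\in\{+,-\}^N$, let $e_0=\begin{pmatrix}-q_0&\kappa_0^{-1}\\ \kappa_0&-q_0^{-1}\end{pmatrix}$ act on the first factor, $e_N=\begin{pmatrix}-q_N^{-1}&\kappa_N\\ \kappa_N^{-1}&-q_N\end{pmatrix}$ on the last factor, and $e_i$, $1\le i\le N-1$, on the factors $i,i+1$ by $v_{++},v_{--}\mapsto0$, $v_{+-}\mapsto-q^{-1}v_{+-}+v_{-+}$, $v_{-+}\mapsto v_{+-}-qv_{-+}$. Put $$\check R_i(x)=\frac{qx-q^{-1}}{q-q^{-1}x}+\frac{x-1}{q-q^{-1}x}e_i,\qquad K_N(x)=\frac{(x+q_N\zeta_N)(x-q_N\zeta_N^{-1})+q_N(x^2-1)e_N}{(1+q_N\zeta_Nx)(1-q_N\zeta_N^{-1}x)},$$ $$K_0(x)=\frac{(x^{-1}+q_0\zeta_0)(x^{-1}-q_0\zeta_0^{-1})+q_0(x^{-2}-1)e_0}{(1+q_0\zeta_0x^{-1})(1-q_0\zeta_0^{-1}x^{-1})}.$$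 Let $(C_b)_{b\in\{+,-\}^N}$ be the parabolic Kazhdan--Lusztig basis of $V^{\otimes N}$ of type BI (where $q_N=q^M$ for an integer $M\ge1$), BII or BIII, given as follows. Regard each $-$ in $b$ as a down arrow and each $+$ as an up arrow; join adjacent pairs (down, up) by arcs, repeatedly, ignoring arrows already joined, until all unpaired up arrows are to the left of all unpaired down arrows. Then $C_b$ is the tensor product of the following vectors, each placed at the corresponding sites: $v_{-+}-q^{-1}v_{+-}$ for an arc; $v_+$ for an unpaired up arrow; and, for the $r$-th unpaired down arrow from the right, $v_--\kappa_Nq_N^{-1}v_+$ ($r$ odd) or $v_-+\kappa_Nq^{-1}q_Nv_+$ ($r$ even) in type BII, and $v_--\kappa_Nq^{r-1}q_N^{-1}v_+$ in type BIII. In type BI it is $v_--\kappa_Nq^{-(M+1-r)}v_+$ for $r\le M$; the unpaired down arrows with $r>M$ are grouped, from right to left, into consecutive pairs, each contributing $v_{--}-\kappa_N^2q^{-1}v_{++}$, and a remaining single one contributes $v_-$. Let $\Psi=\sum_b\Psi_bC_b$ with $\Psi_b\in L$ be a solution of the two-boundary quantum Knizhnik--Zamolodchikov equation $$\Psi(s_0\mathbf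 z)=K_0(s^{-1}z_1)\Psi(\mathbf z),\qquad \Psi(s_i\mathbf z)=\check R_i(z_{i+1}/z_i)\Psi(\mathbf z)\ (1\le i\le N-1),\qquad \Psi(s_N\mathbf z)=K_N(z_N)\Psi(\mathbf z).$$ Then the component $\Psi_0:=\Psi_{(-\cdots-)}$ satisfies $$\hat Y_i\Psi_0=\kappa_0\kappa_N\,q^{-N+2i-1}\,\Psi_0\qquad\text{for all }1\le i\le N.$$ -/

import Mathlib

noncomputable section

namespace BoundaryQKZ

open Matrix

/-! ### Parameters

The number of sites is `N = n + 1`. Sites are indexed by `Fin (n + 1)`, so the site that is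
usually numbered `i` (with `1 ≤ i ≤ N`) is `i - 1` here; the bond between the sites numbered
`j + 1` and `j + 2` is `j : Fin n`, joining `j.castSucc` and `j.succ`. -/

/-- The eight nonzero parameters: the Hecke parameters `q, q₀, q_N`, the shift parameter `s`,
the Baxterization parameters `ζ₀, ζ_N`, and `κ₀, κ_N`. -/
structure Params (F : Type*) [Field F] where
  q : F
  q0 : F
  qN : F
  s : F
  ζ0 : F
  ζN : F
  κ0 : F
  κN : F
  q_ne : q ≠ 0
  q0_ne : q0 ≠ 0
  qN_ne : qN ≠ 0
  s_ne : s ≠ 0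
  ζ0_ne : ζ0 ≠ 0
  ζN_ne : ζN ≠ 0
  κ0_ne : κ0 ≠ 0
  κN_ne : κN ≠ 0

/-! ### Laurent polynomials, rational functions and the affine Weyl group action -/

/-- Laurent polynomials in `z_1, …, z_N`, `N = n + 1`. -/
abbrev Laurent (F : Type*) [Field F] (n : ℕ) := AddMonoidAlgebra F (Fin (n + 1) → ℤ)

/-- Rational functions in `z_1, …, z_N`, `N = n + 1`. -/
abbrev RatFun (F : Type*) [Field F] (n : ℕ) := FractionRing (Laurent F n)

section Weyl

variable {F : Type*} [Field F] {n : ℕ}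

/-- The coordinate function at site `i`. -/
def z (i : Fin (n + 1)) : RatFun F n :=
  algebraMap (Laurent F n) (RatFun F n) (AddMonoidAlgebra.single (Pi.single i 1) 1)

/-- The monomial substitution `z^v ↦ χ(v) z^{g v}`. -/
def twistHom (g : (Fin (n + 1) → ℤ) →+ (Fin (n + 1) → ℤ))
    (χ : Multiplicative (Fin (n + 1) → ℤ) →* F) : Laurent F n →ₐ[F] Laurent F n :=
  AddMonoidAlgebra.lift F (Laurent F n) (Fin (n + 1) → ℤ)
    { toFun := fun v => AddMonoidAlgebra.single (g v.toAdd) (χ v)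
      map_one' := by
        rw [toAdd_one, map_zero, map_one]; rfl
      map_mul' := fun v w => by
        rw [toAdd_mul, map_add, map_mul, AddMonoidAlgebra.single_mul_single] }

theorem twistHom_single (g : (Fin (n + 1) → ℤ) →+ (Fin (n + 1) → ℤ))
    (χ : Multiplicative (Fin (n + 1) → ℤ) →* F) (v : Fin (n + 1) → ℤ) (a : F) :
    twistHom g χ (AddMonoidAlgebra.single v a)
      = AddMonoidAlgebra.single (g v) (a * χ (Multiplicative.ofAdd v)) := by
  unfold twistHom
  rw [AddMonoidAlgebra.lift_single]
  simp

/-- The monomial substitution `z^v ↦ χ(v) z^{g v}` as an automorphism, when it is an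
involution. -/
def twist (g : (Fin (n + 1) → ℤ) →+ (Fin (n + 1) → ℤ))
    (χ : Multiplicative (Fin (n + 1) → ℤ) →* F) (hg : ∀ v, g (g v) = v)
    (hχ : ∀ v, χ (Multiplicative.ofAdd v) * χ (Multiplicative.ofAdd (g v)) = 1) :
    Laurent F n ≃ₐ[F] Laurent F n :=
  have h : (twistHom g χ).comp (twistHom g χ) = AlgHom.id F (Laurent F n) := by
    apply AddMonoidAlgebra.algHom_ext
    · intro v
      simp [twistHom_single, hg, hχ]
    · ext
  AlgEquiv.ofAlgHom (twistHom g χ) (twistHom g χ) h h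

/-- The extension of an automorphism of the Laurent polynomials to rational functions. -/
def extend (φ : Laurent F n ≃ₐ[F] Laurent F n) : RatFun F n ≃ₐ[F] RatFun F n :=
  IsFractionRing.algEquivOfAlgEquiv φ

/-- Negation of one exponent. -/
def negAt (i : Fin (n + 1)) : (Fin (n + 1) → ℤ) →+ (Fin (n + 1) → ℤ) where
  toFun v := fun k => if k = i then - v k else v k
  map_zero' := by ext k; simp
  map_add' v w := by
    ext k
    by_cases h : k = i <;> simp [h]
    ring

/-- Exchange of two exponents. -/
def swapAt (i j : Fin (n + 1)) : (Fin (n + 1) → ℤ) →+ (Fin (n + 1) → ℤ) where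
  toFun v := fun k => v (Equiv.swap i j k)
  map_zero' := by ext k; simp
  map_add' v w := by ext k; simp

/-- The character `v ↦ c^{v_i}`. -/
def powAt (i : Fin (n + 1)) (c : F) (hc : c ≠ 0) :
    Multiplicative (Fin (n + 1) → ℤ) →* F where
  toFun v := c ^ (v.toAdd i)
  map_one' := by simp
  map_mul' v w := by simp [zpow_add₀ hc]

/-- `f(z) ↦ f(s_0 z)`, with `s_0 z = (s² z_1⁻¹, z_2, …, z_N)`. -/
def refl0 (p : Params F) : RatFun F n ≃ₐ[F] RatFun F n :=
  extend (twist (negAt 0) (powAt 0 (p.s ^ 2) (pow_ne_zero 2 p.s_ne))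
    (fun v => by ext k; by_cases h : k = 0 <;> simp [negAt, h])
    (fun v => by
      simp [powAt, negAt, mul_inv_cancel₀ (zpow_ne_zero (v 0) (pow_ne_zero 2 p.s_ne))]))

/-- `f(z) ↦ f(s_i z)`, where `s_i` exchanges the two variables at the bond `j`, `i = j + 1`. -/
def reflBulk (j : Fin n) : RatFun F n ≃ₐ[F] RatFun F n :=
  extend (twist (swapAt j.castSucc j.succ) 1 (fun v => by ext k; simp [swapAt])
    (fun v => by simp))

/-- `f(z) ↦ f(s_N z)`, with `s_N z = (z_1, …, z_{N-1}, z_N⁻¹)`. -/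
def reflN : RatFun F n ≃ₐ[F] RatFun F n :=
  extend (twist (negAt (Fin.last n)) 1
    (fun v => by ext k; by_cases h : k = Fin.last n <;> simp [negAt, h])
    (fun v => by simp))

theorem extend_z (φ : Laurent F n ≃ₐ[F] Laurent F n) (i : Fin (n + 1)) :
    extend φ (z i) = algebraMap (Laurent F n) (RatFun F n)
      (φ (AddMonoidAlgebra.single (Pi.single i 1) 1)) := by
  simp [extend, z]

theorem twist_single (g : (Fin (n + 1) → ℤ) →+ (Fin (n + 1) → ℤ))
    (χ : Multiplicative (Fin (n + 1) → ℤ) →* F) (hg hχ) (v : Fin (n + 1) → ℤ) (a : F) :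
    twist g χ hg hχ (AddMonoidAlgebra.single v a)
      = AddMonoidAlgebra.single (g v) (a * χ (Multiplicative.ofAdd v)) :=
  twistHom_single g χ v a

theorem z_inv (i : Fin (n + 1)) : (z i : RatFun F n)⁻¹ =
    algebraMap (Laurent F n) (RatFun F n) (AddMonoidAlgebra.single (Pi.single i (-1)) 1) := by
  apply inv_eq_of_mul_eq_one_right
  rw [z, ← map_mul, AddMonoidAlgebra.single_mul_single, ← Pi.single_add]
  simp [← AddMonoidAlgebra.one_def]

theorem negAt_single (i : Fin (n + 1)) (a : ℤ) : negAt i (Pi.single i a) = Pi.single i (-a) := by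
  ext k
  by_cases h : k = i
  · subst h; simp [negAt]
  · simp [negAt, h]

theorem negAt_single_of_ne {i k : Fin (n + 1)} (h : k ≠ i) (a : ℤ) :
    negAt i (Pi.single k a) = Pi.single k a := by
  ext l
  by_cases hl : l = i
  · subst hl; simp [negAt, Ne.symm h]
  · simp [negAt, hl]

theorem refl0_z_zero (p : Params F) :
    refl0 p (z (0 : Fin (n + 1))) = algebraMap F (RatFun F n) (p.s ^ 2) * (z 0)⁻¹ := by
  rw [refl0, extend_z, twist_single, negAt_single, z_inv, IsScalarTower.algebraMap_apply F
    (Laurent F n) (RatFun F n), ← map_mul, AddMonoidAlgebra.coe_algebraMap]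
  simp [powAt, AddMonoidAlgebra.single_mul_single]

theorem refl0_z_ne (p : Params F) {k : Fin (n + 1)} (h : k ≠ 0) :
    refl0 p (z k) = z k := by
  rw [refl0, extend_z, twist_single, negAt_single_of_ne h]
  simp [powAt, z, Ne.symm h]

theorem reflN_z_last : reflN (z (Fin.last n) : RatFun F n) = (z (Fin.last n))⁻¹ := by
  rw [reflN, extend_z, twist_single, negAt_single, z_inv]
  simp

theorem reflN_z_ne {k : Fin (n + 1)} (h : k ≠ Fin.last n) :
    reflN (z k : RatFun F n) = z k := by
  rw [reflN, extend_z, twist_single, negAt_single_of_ne h]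
  simp [z]

theorem reflBulk_z (j : Fin n) (k : Fin (n + 1)) :
    reflBulk j (z k : RatFun F n) = z (Equiv.swap j.castSucc j.succ k) := by
  have h : swapAt j.castSucc j.succ (Pi.single k (1 : ℤ))
      = Pi.single (Equiv.swap j.castSucc j.succ k) 1 := by
    ext l
    simp only [swapAt, AddMonoidHom.coe_mk, ZeroHom.coe_mk, Pi.single_apply]
    simp [Equiv.swap_apply_eq_iff]
  rw [reflBulk, extend_z, twist_single, h]
  simp [z]

theorem z_injective : Function.Injective (z : Fin (n + 1) → RatFun F n) := by
  intro i j h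
  have h1 := IsFractionRing.injective (Laurent F n) (RatFun F n) h
  have h2 : (Pi.single i 1 : Fin (n + 1) → ℤ) = Pi.single j 1 :=
    AddMonoidAlgebra.of_injective (R := F) (M := Fin (n + 1) → ℤ) h1
  by_contra hij
  have h3 := congrFun h2 i
  simp [hij] at h3

theorem z_ne_zero (i : Fin (n + 1)) : (z i : RatFun F n) ≠ 0 := by
  intro h
  have h1 := IsFractionRing.injective (Laurent F n) (RatFun F n) (h.trans (map_zero _).symm)
  simp at h1

end Weyl

/-! ### The operators of the polynomial representation -/

section Noumi

variable {F : Type*} [Field F] {n : ℕ}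

/-- The operator `f ↦ -t f - t⁻¹ c (σ f - f)`. -/
def demazureLusztig (t : F) (c : RatFun F n) (σ : RatFun F n ≃ₐ[F] RatFun F n) :
    Module.End F (RatFun F n) :=
  -(t • LinearMap.id) - t⁻¹ • (LinearMap.mulLeft F c ∘ₗ (σ.toLinearMap - LinearMap.id))

theorem demazureLusztig_apply (t : F) (c : RatFun F n) (σ : RatFun F n ≃ₐ[F] RatFun F n)
    (f : RatFun F n) :
    demazureLusztig t c σ f = -(t • f) - t⁻¹ • (c * (σ f - f)) := by
  simp [demazureLusztig]

/-- A scalar parameter, as a constant rational function. -/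
abbrev cst (a : F) : RatFun F n := algebraMap F (RatFun F n) a

/-- The operator `T̂_0`. -/
def hatT0 (p : Params F) : Module.End F (RatFun F n) :=
  demazureLusztig p.q0
    ((1 - cst (p.s * p.q0 * p.ζ0⁻¹) * (z 0)⁻¹) * (1 + cst (p.s * p.q0 * p.ζ0) * (z 0)⁻¹) /
      (1 - cst (p.s ^ 2) * (z 0)⁻¹ ^ 2)) (refl0 p)

/-- The operator `T̂_i`, `1 ≤ i ≤ N - 1`, at the bond `j`, `i = j + 1`. -/
def hatT (p : Params F) (j : Fin n) : Module.End F (RatFun F n) :=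
  demazureLusztig p.q
    ((1 - cst (p.q ^ 2) * z j.castSucc * (z j.succ)⁻¹) / (1 - z j.castSucc * (z j.succ)⁻¹))
    (reflBulk j)

/-- The operator `T̂_N`. -/
def hatTN (p : Params F) : Module.End F (RatFun F n) :=
  demazureLusztig p.qN
    ((1 + cst (p.qN * p.ζN) * z (Fin.last n)) * (1 - cst (p.qN * p.ζN⁻¹) * z (Fin.last n)) /
      (1 - z (Fin.last n) ^ 2)) reflN

theorem reflBulk_reflBulk (j : Fin n) (f : RatFun F n) : reflBulk j (reflBulk j f) = f := by
  have h : ∀ a : Laurent F n, reflBulk j (reflBulk j (algebraMap (Laurent F n) (RatFun F n) a))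
      = algebraMap (Laurent F n) (RatFun F n) a := by
    intro a
    simp only [reflBulk, extend, IsFractionRing.algEquivOfAlgEquiv_algebraMap]
    congr 1
    exact (twist (F := F) (swapAt j.castSucc j.succ) 1 _ _).apply_symm_apply a
  obtain ⟨a, b, -, rfl⟩ := IsFractionRing.div_surjective (A := Laurent F n) f
  rw [map_div₀, map_div₀, h, h]

/-- The quadratic relation `(T̂_i + q)(T̂_i - q⁻¹) = 0`, in a form that exhibits the inverse. -/
theorem hatT_quadratic (p : Params F) (j : Fin n) (f : RatFun F n) :
    hatT p j (hatT p j f) + (p.q - p.q⁻¹) • hatT p j f = f := by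
  have hne : (z j.castSucc : RatFun F n) ≠ z j.succ := fun h =>
    absurd (z_injective h) (Fin.castSucc_lt_succ).ne
  have h1 := z_ne_zero (F := F) j.castSucc
  have h2 := z_ne_zero (F := F) j.succ
  have hq : (cst p.q : RatFun F n) ≠ 0 := by simpa using p.q_ne
  have h3 := sub_ne_zero.mpr hne
  have h4 := sub_ne_zero.mpr hne.symm
  simp only [hatT, demazureLusztig_apply, Algebra.smul_def, map_sub, map_neg, map_mul, map_div₀,
    map_one, map_inv₀, AlgEquiv.commutes, reflBulk_reflBulk, reflBulk_z, Equiv.swap_apply_left,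
    Equiv.swap_apply_right, map_pow]
  simp only [cst] at hq
  have h5 : (1 : RatFun F n) - z j.castSucc * (z j.succ)⁻¹ ≠ 0 := by
    rw [← mul_inv_cancel₀ h2, ← sub_mul]
    exact mul_ne_zero h4 (inv_ne_zero h2)
  have h6 : (1 : RatFun F n) - z j.succ * (z j.castSucc)⁻¹ ≠ 0 := by
    rw [← mul_inv_cancel₀ h1, ← sub_mul]
    exact mul_ne_zero h3 (inv_ne_zero h1)
  generalize reflBulk j f = g
  generalize algebraMap F (RatFun F n) p.q = t at *
  generalize (z j.castSucc : RatFun F n) = x at *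
  generalize (z j.succ : RatFun F n) = y at *
  have h7 : (1 - x * y⁻¹) = (y - x) / y := by field_simp
  have h8 : (1 - y * x⁻¹) = -((y - x) / x) := by field_simp; ring
  rw [h7, h8]
  field_simp
  ring

/-- `T̂_i`, `1 ≤ i ≤ N - 1`, as an invertible operator. -/
def hatTUnit (p : Params F) (j : Fin n) : (Module.End F (RatFun F n))ˣ where
  val := hatT p j
  inv := hatT p j + (p.q - p.q⁻¹) • 1
  val_inv := by
    ext1 f
    simpa using hatT_quadratic p j f
  inv_val := by
    ext1 f
    simpa using hatT_quadratic p j f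

/-- The Cherednik–Noumi operator
`Ŷ_i = T̂_i ⋯ T̂_{N-1} T̂_N T̂_{N-1} ⋯ T̂_1 T̂_0 T̂_1⁻¹ ⋯ T̂_{i-1}⁻¹`,
where the site `i : Fin (n + 1)` is the one numbered `i + 1`. -/
def hatY (p : Params F) (i : Fin (n + 1)) : Module.End F (RatFun F n) :=
  (((List.finRange n).filter fun j => i.val ≤ j.val).map (hatT p)).prod
    * hatTN p
    * ((List.finRange n).reverse.map (hatT p)).prod
    * hatT0 p
    * (((List.finRange n).filter fun j => j.val < i.val).map
        fun j => (((hatTUnit p j)⁻¹ : (Module.End F (RatFun F n))ˣ) :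
          Module.End F (RatFun F n))).prod

end Noumi

/-! ### The spin representation of the two-boundary Temperley–Lieb algebra -/

section Spin

variable {F : Type*} [Field F] {n : ℕ}

/-- Binary strings of length `N = n + 1`; the letter `+` is `0` and the letter `-` is `1`. They
index the standard basis `v_ε` of `V^{⊗N}`, and a vector is given by its coordinates. -/
abbrev Str (n : ℕ) := Fin (n + 1) → Fin 2

/-- An operator acting on the tensor factor `i` only. -/
def oneSite (A : Matrix (Fin 2) (Fin 2) F) (i : Fin (n + 1)) : Matrix (Str n) (Str n) F :=
  Matrix.of fun ε ε' => if ∀ k, k ≠ i → ε k = ε' k then A (ε i) (ε' i) else 0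

/-- An operator acting on the two tensor factors of the bond `j` only. The basis of `V ⊗ V` is
ordered as `(++, +-, -+, --)`. -/
def twoSite (A : Matrix (Fin (2 * 2)) (Fin (2 * 2)) F) (j : Fin n) : Matrix (Str n) (Str n) F :=
  Matrix.of fun ε ε' =>
    if ∀ k, k ≠ j.castSucc → k ≠ j.succ → ε k = ε' k then
      A (finProdFinEquiv (ε j.castSucc, ε j.succ)) (finProdFinEquiv (ε' j.castSucc, ε' j.succ))
    else 0

/-- The generator `e_0`. -/
def e0 (p : Params F) : Matrix (Str n) (Str n) F :=
  oneSite !![-p.q0, p.κ0⁻¹; p.κ0, -p.q0⁻¹] 0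

/-- The generator `e_i`, `1 ≤ i ≤ N - 1`, at the bond `j`, `i = j + 1`. -/
def e (p : Params F) (j : Fin n) : Matrix (Str n) (Str n) F :=
  twoSite !![0, 0, 0, 0; 0, -p.q⁻¹, 1, 0; 0, 1, -p.q, 0; 0, 0, 0, 0] j

/-- The generator `e_N`. -/
def eN (p : Params F) : Matrix (Str n) (Str n) F :=
  oneSite !![-p.qN⁻¹, p.κN; p.κN⁻¹, -p.qN] (Fin.last n)

/-- Extension of scalars from the parameter field to rational functions. -/
abbrev ext (A : Matrix (Str n) (Str n) F) : Matrix (Str n) (Str n) (RatFun F n) :=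
  A.map (algebraMap F (RatFun F n))

/-- The `R`-matrix `Ř_i(x)` at the bond `j`, `i = j + 1`. -/
def Rcheck (p : Params F) (j : Fin n) (x : RatFun F n) : Matrix (Str n) (Str n) (RatFun F n) :=
  ((cst p.q * x - cst p.q⁻¹) / (cst p.q - cst p.q⁻¹ * x)) • 1
    + ((x - 1) / (cst p.q - cst p.q⁻¹ * x)) • ext (e p j)

/-- The `K`-matrix `K_N(x)`. -/
def KN (p : Params F) (x : RatFun F n) : Matrix (Str n) (Str n) (RatFun F n) :=
  ((x + cst (p.qN * p.ζN)) * (x - cst (p.qN * p.ζN⁻¹)) /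
      ((1 + cst (p.qN * p.ζN) * x) * (1 - cst (p.qN * p.ζN⁻¹) * x))) • 1
    + (cst p.qN * (x ^ 2 - 1) /
      ((1 + cst (p.qN * p.ζN) * x) * (1 - cst (p.qN * p.ζN⁻¹) * x))) • ext (eN p)

/-- The `K`-matrix `K_0(x)`. -/
def K0 (p : Params F) (x : RatFun F n) : Matrix (Str n) (Str n) (RatFun F n) :=
  ((x⁻¹ + cst (p.q0 * p.ζ0)) * (x⁻¹ - cst (p.q0 * p.ζ0⁻¹)) /
      ((1 + cst (p.q0 * p.ζ0) * x⁻¹) * (1 - cst (p.q0 * p.ζ0⁻¹) * x⁻¹))) • 1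
    + (cst p.q0 * (x⁻¹ ^ 2 - 1) /
      ((1 + cst (p.q0 * p.ζ0) * x⁻¹) * (1 - cst (p.q0 * p.ζ0⁻¹) * x⁻¹))) • ext (e0 p)

end Spin

/-! ### Kazhdan–Lusztig bases

The letter `-` is a down arrow and the letter `+` an up arrow. Adjacent pairs "down, up" are
joined by arcs, repeatedly, as for opening and closing parentheses; the unpaired arrows are then
up arrows followed by down arrows. -/

section KL

variable {F : Type*} [Field F] {n : ℕ}

/-- The number of letters `a` of `b` at the sites `k` with `i < k ≤ j`. -/
def countIoc (b : Str n) (a : Fin 2) (i j : Fin (n + 1)) : ℕ :=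
  ((Finset.Ioc i j).filter fun k => b k = a).card

/-- The sites `i < j` carry a down and an up arrow joined by an arc: `j` is the first site
after `i` such that `(i, j]` contains more up arrows than down arrows. -/
def IsArc (b : Str n) (i j : Fin (n + 1)) : Prop :=
  i < j ∧ b i = 1 ∧ countIoc b 0 i j = countIoc b 1 i j + 1 ∧
    ∀ k, i < k → k < j → countIoc b 0 i k ≤ countIoc b 1 i k

instance (b : Str n) (i j : Fin (n + 1)) : Decidable (IsArc b i j) :=
  inferInstanceAs (Decidable (_ ∧ _ ∧ _ ∧ _))

/-- An unpaired up arrow. -/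
def IsFreeUp (b : Str n) (i : Fin (n + 1)) : Prop := b i = 0 ∧ ∀ k, ¬ IsArc b k i

instance (b : Str n) (i : Fin (n + 1)) : Decidable (IsFreeUp b i) :=
  inferInstanceAs (Decidable (_ ∧ _))

/-- An unpaired down arrow. -/
def IsFreeDown (b : Str n) (i : Fin (n + 1)) : Prop := b i = 1 ∧ ∀ k, ¬ IsArc b i k

instance (b : Str n) (i : Fin (n + 1)) : Decidable (IsFreeDown b i) :=
  inferInstanceAs (Decidable (_ ∧ _))

/-- An unpaired down arrow at `i` is the `rank b i`-th unpaired down arrow from the right. -/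
def rank (b : Str n) (i : Fin (n + 1)) : ℕ :=
  ((Finset.Ici i).filter fun k => IsFreeDown b k).card

/-- The three types of Kazhdan–Lusztig bases; type BI depends on an integer `M`. -/
inductive KLType
  | BI (M : ℕ)
  | BII
  | BIII

/-- The condition on the Hecke parameters: `q_N = q^M` with `M ≥ 1` for type BI. -/
def KLType.Compatible : KLType → Params F → Prop
  | .BI M, p => 1 ≤ M ∧ p.qN = p.q ^ M
  | .BII, _ => True
  | .BIII, _ => True

/-- Coefficients of the vector `v_{-+} - q⁻¹ v_{+-}` of an arc. -/
def arcVec (p : Params F) : Matrix (Fin 2) (Fin 2) F := !![0, -p.q⁻¹; 1, 0]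

/-- Coefficients of the vector `v_{--} - κ_N² q⁻¹ v_{++}` of a dashed arc. -/
def dashVec (p : Params F) : Matrix (Fin 2) (Fin 2) F := !![-(p.κN ^ 2 * p.q⁻¹), 0; 0, 1]

/-- Coefficients of `v_+`, the vector of an unpaired up arrow. -/
def upVec : Fin 2 → F := ![1, 0]

/-- Coefficients of the vector of the `r`-th unpaired down arrow from the right.
For type BI, the first `M` of these (from the right) carry the integers `M, M - 1, …, 1`, and the
others are joined in pairs by dashed arcs, from right to left; the factor of a dashed arc is
not included here, and an arrow that remains single contributes `v_-`. -/
def downVec (p : Params F) (X : KLType) (r : ℕ) : Fin 2 → F :=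
  match X with
  | .BI M => if r ≤ M then ![-(p.κN * p.q⁻¹ ^ (M + 1 - r)), 1] else ![0, 1]
  | .BII => if Odd r then ![-(p.κN * p.qN⁻¹), 1] else ![p.κN * p.q⁻¹ * p.qN, 1]
  | .BIII => ![-(p.κN * p.q ^ (r - 1) * p.qN⁻¹), 1]

/-- The sites `i < j` carry unpaired down arrows joined by a dashed arc: the ranks are
`M + 2 t + 2` and `M + 2 t + 1` for some `t`. -/
def IsDashed (X : KLType) (b : Str n) (i j : Fin (n + 1)) : Prop :=
  match X with
  | .BI M => IsFreeDown b i ∧ IsFreeDown b j ∧ M < rank b j ∧ Odd (rank b j - M) ∧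
      rank b i = rank b j + 1
  | .BII => False
  | .BIII => False

instance (X : KLType) (b : Str n) (i j : Fin (n + 1)) : Decidable (IsDashed X b i j) :=
  match X with
  | .BI _ => inferInstanceAs (Decidable (_ ∧ _ ∧ _ ∧ _ ∧ _))
  | .BII => inferInstanceAs (Decidable False)
  | .BIII => inferInstanceAs (Decidable False)

/-- The coefficient of `v_ε` in the Kazhdan–Lusztig basis vector `C_b`: the product over the
components of the diagram of `b`. -/
def klCoeff (p : Params F) (X : KLType) (b ε : Str n) : F :=
  (∏ i, ∏ j, if IsArc b i j then arcVec p (ε i) (ε j) else 1)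
    * (∏ i, if IsFreeUp b i then upVec (ε i) else 1)
    * (∏ i, ∏ j, if IsDashed X b i j then dashVec p (ε i) (ε j) else 1)
    * (∏ i, if IsFreeDown b i ∧ ∀ k, ¬ IsDashed X b i k ∧ ¬ IsDashed X b k i then
        downVec p X (rank b i) (ε i) else 1)

end KL

/-! ### The boundary quantum Knizhnik–Zamolodchikov equation -/

section QKZ

variable {F : Type*} [Field F] {n : ℕ}

/-- The vector `Ψ = ∑_b Ψ_b C_b`, in coordinates with respect to the standard basis. -/
def klVector (p : Params F) (X : KLType) (Ψ : Str n → RatFun F n) : Str n → RatFun F n :=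
  fun ε => ∑ b, Ψ b * cst (klCoeff p X b ε)

/-- The two-boundary quantum Knizhnik–Zamolodchikov equation for a function `Φ` with values
in `V^{⊗N}`:
`Φ(s_0 z) = K_0(s⁻¹ z_1) Φ(z)`, `Φ(s_i z) = Ř_i(z_{i+1} / z_i) Φ(z)` for `1 ≤ i ≤ N - 1`, and
`Φ(s_N z) = K_N(z_N) Φ(z)`. -/
def IsQKZSolution (p : Params F) (Φ : Str n → RatFun F n) : Prop :=
  (fun ε => refl0 p (Φ ε)) = K0 p (cst p.s⁻¹ * z 0) *ᵥ Φ ∧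
  (∀ j : Fin n, (fun ε => reflBulk j (Φ ε)) = Rcheck p j (z j.succ / z j.castSucc) *ᵥ Φ) ∧
  (fun ε => reflN (Φ ε)) = KN p (z (Fin.last n)) *ᵥ Φ

/-- The string `b_0 = (-…-)`. -/
def b0 : Str n := fun _ => 1

end QKZ

end BoundaryQKZ

end

namespace BoundaryQKZ

open scoped Matrix

section Aux

variable {F : Type*} [Field F] {n : ℕ}

/-! Reading the qKZ equation one component at a time turns the action of the Hecke operators on
functions into the action of the Temperley–Lieb generators on spins: each operator sends `Φ ε` to
the component at `ε` of (e + t⁻¹)Φ, with t the matching Hecke parameter (`hatT0_of_qkz`,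
`hatT_of_qkz`, `hatTN_of_qkz`).

Only the components with at most one up arrow are then needed. The bulk operators scale `Φ b0` by
q⁻¹; the left boundary operator sends it to κ₀ times the component with `+` at the first site; the
bulk operators carry that `+` step by step to the last site; the right boundary operator removes it
with a factor κ_N. In Ŷ_i the i - 1 inverses give q^(i-1) and the N - i leftmost bulk operators give
q^(-(N-i)), which together with κ₀κ_N is the eigenvalue (`hatY_b0`).

The passage to the Kazhdan–Lusztig basis costs nothing: C_b involves v_{-…-} only for b = (-…-), and
there with coefficient 1 (`klCoeff_b0`), so Ψ_0 is the standard component `Φ b0`. -/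

/-- The string with the letter `+` at the site `k` and `-` at all other sites. -/
def upAt (k : Fin (n + 1)) : Str n := Function.update b0 k 0

theorem upAt_self (k : Fin (n + 1)) : upAt k k = 0 := by simp [upAt]

theorem upAt_of_ne {k l : Fin (n + 1)} (h : l ≠ k) : upAt k l = 1 := by simp [upAt, b0, h]

theorem upAt_ne_b0 (k : Fin (n + 1)) : upAt k ≠ b0 := fun h => by
  simpa [upAt_self, b0] using congrFun h k

theorem upAt_injective : Function.Injective (upAt : Fin (n + 1) → Str n) := fun k l h => by
  by_contra hkl
  simpa [upAt_self, upAt_of_ne hkl] using congrFun h k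

/-! ### Nonvanishing of denominators -/

theorem cst_mul_z (a : F) (i : Fin (n + 1)) : cst a * (z i : RatFun F n) =
    algebraMap (Laurent F n) (RatFun F n) (AddMonoidAlgebra.single (Pi.single i 1) a) := by
  rw [z, cst, IsScalarTower.algebraMap_apply F (Laurent F n) (RatFun F n), ← map_mul,
    AddMonoidAlgebra.coe_algebraMap]
  simp [AddMonoidAlgebra.single_mul_single]

/-- Distinct monomials are linearly independent, whatever the value of the scalar. With a = q² this
keeps the denominator of the R-matrix nonzero even for specialized q. -/
theorem cst_mul_z_ne_z (a : F) {i j : Fin (n + 1)} (h : i ≠ j) :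
    cst a * (z i : RatFun F n) ≠ z j := by
  rw [cst_mul_z, z]
  intro h1
  have h2 := congrArg (fun f : Laurent F n => f.coeff (Pi.single j 1))
    (IsFractionRing.injective (Laurent F n) (RatFun F n) h1)
  have h3 : (Pi.single i 1 : Fin (n + 1) → ℤ) ≠ Pi.single j 1 := fun h4 => by
    simpa [h] using congrFun h4 i
  simp [h3] at h2

theorem z_ne_cst (a : F) (i : Fin (n + 1)) : (z i : RatFun F n) ≠ cst a := by
  rw [z, cst, IsScalarTower.algebraMap_apply F (Laurent F n) (RatFun F n),
    AddMonoidAlgebra.coe_algebraMap]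
  intro h1
  have h2 := congrArg (fun f : Laurent F n => f.coeff (Pi.single i 1))
    (IsFractionRing.injective (Laurent F n) (RatFun F n) h1)
  simp at h2

theorem cst_ne_zero {a : F} (ha : a ≠ 0) : (cst a : RatFun F n) ≠ 0 := by simpa using ha

theorem one_add_cst_mul_z_ne_zero {a : F} (ha : a ≠ 0) (i : Fin (n + 1)) :
    (1 : RatFun F n) + cst a * z i ≠ 0 := by
  have h := z_ne_cst (n := n) (-a⁻¹) i
  contrapose! h
  have ha' := cst_ne_zero (n := n) ha
  simp only [cst, map_neg, map_inv₀] at *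
  field_simp
  linear_combination h

theorem one_sub_cst_mul_z_ne_zero {a : F} (ha : a ≠ 0) (i : Fin (n + 1)) :
    (1 : RatFun F n) - cst a * z i ≠ 0 := by
  have h := one_add_cst_mul_z_ne_zero (n := n) (neg_ne_zero.mpr ha) i
  simpa [cst, sub_eq_add_neg] using h

theorem one_add_cst_mul_z_inv_ne_zero (a : F) (i : Fin (n + 1)) :
    (1 : RatFun F n) + cst a * (z i)⁻¹ ≠ 0 := by
  have h := z_ne_cst (n := n) (-a) i
  have hz := z_ne_zero (F := F) i
  contrapose! h
  simp only [cst, map_neg] at *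
  field_simp at h
  linear_combination h

theorem one_sub_cst_mul_z_inv_ne_zero (a : F) (i : Fin (n + 1)) :
    (1 : RatFun F n) - cst a * (z i)⁻¹ ≠ 0 := by
  have h := one_add_cst_mul_z_inv_ne_zero (n := n) (-a) i
  simpa [cst, sub_eq_add_neg] using h

/-! ### The component of the string of down arrows -/

/-- An up arrow of `b` is either free, contributing v_+, or the end of an arc, contributing a
combination of v_{-+} and v_{+-}; both kill the coefficient of v_{-…-}. -/
theorem klCoeff_b0 (p : Params F) (X : KLType) (b : Str n) :
    klCoeff p X b b0 = if b = b0 then 1 else 0 := by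
  split_ifs with h
  · subst h
    have h1 : ∀ i j : Fin (n + 1), ¬ IsArc b0 i j := by
      rintro i j ⟨-, -, h, -⟩
      simp [countIoc, b0] at h
    have h2 : ∀ i : Fin (n + 1), ¬ IsFreeUp b0 i := by
      rintro i ⟨h, -⟩
      simp [b0] at h
    -- All three types normalize the coefficient of v_- to 1; their differences lie in the terms
    -- with up arrows.
    have h3 : ∀ r, downVec p X r 1 = 1 := by
      intro r
      cases X <;> simp only [downVec] <;> (try split_ifs) <;> simp
    unfold klCoeff
    simp only [h1, h2, if_false, b0, h3]
    simp [dashVec]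
  · obtain ⟨i, hi⟩ := Function.ne_iff.mp h
    have hi : b i = 0 := by
      simp only [b0] at hi
      omega
    by_cases hu : IsFreeUp b i
    · have h0 : (∏ i, if IsFreeUp b i then (upVec (b0 i) : F) else 1) = 0 :=
        Finset.prod_eq_zero (Finset.mem_univ i) (by simp [hu, upVec, b0])
      simp [klCoeff, h0]
    · have : ∃ k, IsArc b k i := by
        by_contra! h1
        exact hu ⟨hi, h1⟩
      obtain ⟨k, hk⟩ := this
      have h0 : (∏ i, ∏ j, if IsArc b i j then arcVec p (b0 i) (b0 j) else 1) = 0 :=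
        Finset.prod_eq_zero (Finset.mem_univ k)
          (Finset.prod_eq_zero (Finset.mem_univ i) (by simp [hk, arcVec, b0]))
      simp [klCoeff, h0]

theorem klVector_b0 (p : Params F) (X : KLType) (Ψ : Str n → RatFun F n) :
    klVector p X Ψ b0 = Ψ b0 := by
  simp [klVector, klCoeff_b0, apply_ite (algebraMap F (RatFun F n))]

/-! ### Matrix entries of the generators -/

theorem ext_oneSite_mulVec (A : Matrix (Fin 2) (Fin 2) F) (i : Fin (n + 1))
    (Φ : Str n → RatFun F n) {ε : Str n} (hε : ∀ k, k ≠ i → ε k = 1) :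
    (ext (oneSite A i) *ᵥ Φ) ε
      = cst (A (ε i) 0) * Φ (upAt i) + cst (A (ε i) 1) * Φ b0 := by
  rw [Matrix.mulVec, dotProduct, Finset.sum_eq_add (upAt i) b0 (upAt_ne_b0 i)]
  · have h1 : ∀ k, k ≠ i → ε k = upAt i k := fun k hk => by rw [hε k hk, upAt_of_ne hk]
    have h2 : ∀ k, k ≠ i → ε k = b0 k := hε
    simp only [ext, oneSite, Matrix.map_apply, Matrix.of_apply, if_pos h1, if_pos h2, upAt_self]
    rfl
  · rintro ε' - ⟨hu, hb⟩
    have h : ¬ ∀ k, k ≠ i → ε k = ε' k := by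
      intro h
      by_cases h0 : ε' i = 0
      · exact hu (funext fun k => by
          by_cases hk : k = i
          · subst hk; rw [h0, upAt_self]
          · rw [← h k hk, hε k hk, upAt_of_ne hk])
      · exact hb (funext fun k => by
          by_cases hk : k = i
          · subst hk; simp only [b0]; omega
          · rw [← h k hk, hε k hk, b0])
    simp [oneSite, h]
  · simp
  · simp

theorem ext_twoSite_mulVec_b0 {A : Matrix (Fin (2 * 2)) (Fin (2 * 2)) F}
    (hA : ∀ k, A (finProdFinEquiv (1, 1)) k = 0) (j : Fin n) (Φ : Str n → RatFun F n) :
    (ext (twoSite A j) *ᵥ Φ) b0 = 0 :=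
  Finset.sum_eq_zero fun ε' _ => by simp [twoSite, b0, hA]

/-- The two hypotheses on `A` say that the row of `+-` does not reach `++` or `--`, so a single up
arrow stays on the bond. -/
theorem ext_twoSite_mulVec_upAt {A : Matrix (Fin (2 * 2)) (Fin (2 * 2)) F}
    (hA0 : A (finProdFinEquiv (0, 1)) (finProdFinEquiv (0, 0)) = 0)
    (hA1 : A (finProdFinEquiv (0, 1)) (finProdFinEquiv (1, 1)) = 0)
    (j : Fin n) (Φ : Str n → RatFun F n) :
    (ext (twoSite A j) *ᵥ Φ) (upAt j.castSucc) =
      cst (A (finProdFinEquiv (0, 1)) (finProdFinEquiv (0, 1))) * Φ (upAt j.castSucc)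
        + cst (A (finProdFinEquiv (0, 1)) (finProdFinEquiv (1, 0))) * Φ (upAt j.succ) := by
  have hj : j.castSucc ≠ j.succ := Fin.castSucc_lt_succ.ne
  rw [Matrix.mulVec, dotProduct, Finset.sum_eq_add (upAt j.castSucc) (upAt j.succ)
    (fun h => hj (upAt_injective h))]
  · have h : ∀ k, k ≠ j.castSucc → k ≠ j.succ → upAt j.castSucc k = upAt j.succ k :=
      fun k h1 h2 => by rw [upAt_of_ne h1, upAt_of_ne h2]
    simp only [ext, twoSite, Matrix.map_apply, Matrix.of_apply, if_pos h, upAt_self, upAt_of_ne hj,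
      upAt_of_ne hj.symm, implies_true, if_true]
  · rintro ε' - ⟨hu, hv⟩
    by_cases h : ∀ k, k ≠ j.castSucc → k ≠ j.succ → upAt j.castSucc k = ε' k
    · have h01 : ∀ x y : Fin 2, ¬ (x = 0 ∧ y = 1) → ¬ (x = 1 ∧ y = 0) →
          A (finProdFinEquiv (0, 1)) (finProdFinEquiv (x, y)) = 0 := by
        intro x y h1 h2
        fin_cases x <;> fin_cases y
        · exact hA0
        · simp at h1
        · simp at h2
        · exact hA1
      simp only [ext, twoSite, Matrix.map_apply, Matrix.of_apply, if_pos h, upAt_self,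
        upAt_of_ne hj.symm]
      rw [h01]
      · simp
      · rintro ⟨h1, h2⟩
        refine hu (funext fun k => ?_)
        by_cases hk : k = j.castSucc
        · subst hk; rw [h1, upAt_self]
        by_cases hk' : k = j.succ
        · subst hk'; rw [h2, upAt_of_ne hk]
        · rw [h k hk hk']
      · rintro ⟨h1, h2⟩
        refine hv (funext fun k => ?_)
        by_cases hk : k = j.succ
        · subst hk; rw [h2, upAt_self]
        by_cases hk' : k = j.castSucc
        · subst hk'; rw [h1, upAt_of_ne hk]
        · rw [← h k hk' hk, upAt_of_ne hk, upAt_of_ne hk']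
    · simp [twoSite, h]
  · simp
  · simp

theorem ext_e_mulVec_b0 (p : Params F) (j : Fin n) (Φ : Str n → RatFun F n) :
    (ext (e p j) *ᵥ Φ) b0 = 0 :=
  ext_twoSite_mulVec_b0 (fun k => by fin_cases k <;> rfl) j Φ

theorem ext_e_mulVec_upAt (p : Params F) (j : Fin n) (Φ : Str n → RatFun F n) :
    (ext (e p j) *ᵥ Φ) (upAt j.castSucc) =
      -cst p.q⁻¹ * Φ (upAt j.castSucc) + Φ (upAt j.succ) := by
  refine (ext_twoSite_mulVec_upAt rfl rfl j Φ).trans ?_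
  change cst (-p.q⁻¹) * _ + cst 1 * _ = _
  simp [cst]

/-! ### The quantum Knizhnik–Zamolodchikov equation in terms of Hecke operators -/

/-- The product c·d = -t cancels the prefactor -t⁻¹, leaving -t f + g + (t + t⁻¹) f. Here g stands
for a component of eΦ. -/
theorem demazureLusztig_eq_of_sub {t : F} (ht : t ≠ 0) {c d : RatFun F n}
    {σ : RatFun F n ≃ₐ[F] RatFun F n} {f g : RatFun F n} (hcd : c * d = -cst t)
    (h : σ f - f = d * (g + (cst t + cst t⁻¹) * f)) :
    demazureLusztig t c σ f = g + cst t⁻¹ * f := by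
  have ht' := cst_ne_zero (n := n) ht
  rw [demazureLusztig_apply, h, ← mul_assoc, hcd]
  simp only [Algebra.smul_def, cst, map_inv₀] at *
  field_simp
  ring

theorem smul_one_add_smul_mulVec (a c : RatFun F n) (A : Matrix (Str n) (Str n) (RatFun F n))
    (Φ : Str n → RatFun F n) (ε : Str n) :
    ((a • 1 + c • A) *ᵥ Φ) ε = a * Φ ε + c * (A *ᵥ Φ) ε := by
  simp [Matrix.add_mulVec, Matrix.smul_mulVec]

/-- Both boundaries at once: y is z_N on the right and s z_1⁻¹ on the left. -/
theorem demazureLusztig_eq_of_boundary {t ζ : F} (ht : t ≠ 0) (hζ : ζ ≠ 0) {y c : RatFun F n}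
    (h1 : 1 + cst (t * ζ) * y ≠ 0) (h2 : 1 - cst (t * ζ⁻¹) * y ≠ 0) (h3 : 1 - y ^ 2 ≠ 0)
    (hc : c = (1 + cst (t * ζ) * y) * (1 - cst (t * ζ⁻¹) * y) / (1 - y ^ 2))
    {σ : RatFun F n ≃ₐ[F] RatFun F n} {f g : RatFun F n}
    (h : σ f = (y + cst (t * ζ)) * (y - cst (t * ζ⁻¹)) /
        ((1 + cst (t * ζ) * y) * (1 - cst (t * ζ⁻¹) * y)) * f
      + cst t * (y ^ 2 - 1) / ((1 + cst (t * ζ) * y) * (1 - cst (t * ζ⁻¹) * y)) * g) :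
    demazureLusztig t c σ f = g + cst t⁻¹ * f := by
  have hD := mul_ne_zero h1 h2
  have ht' := cst_ne_zero (n := n) ht
  have hζ' := cst_ne_zero (n := n) hζ
  -- The terms linear in y agree on both sides, so ζ survives only in the common denominator, which
  -- the coefficient `c` cancels.
  have hnum : (y + cst (t * ζ)) * (y - cst (t * ζ⁻¹)) =
      (1 + cst (t * ζ) * y) * (1 - cst (t * ζ⁻¹) * y)
        + cst t * (y ^ 2 - 1) * (cst t + cst t⁻¹) := by
    simp only [cst, map_mul, map_inv₀] at *
    field_simp
    ring
  rw [hnum] at h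
  generalize (1 + cst (t * ζ) * y) * (1 - cst (t * ζ⁻¹) * y) = D at *
  refine demazureLusztig_eq_of_sub ht (d := cst t * (y ^ 2 - 1) / D) ?_ ?_
  · rw [hc]
    field_simp
    ring
  · rw [h]
    field_simp
    ring

variable {p : Params F} {Φ : Str n → RatFun F n}

theorem hatT_of_qkz (h : IsQKZSolution p Φ) (j : Fin n) (ε : Str n) :
    hatT p j (Φ ε) = (ext (e p j) *ᵥ Φ) ε + cst p.q⁻¹ * Φ ε := by
  have hne : (z j.castSucc : RatFun F n) ≠ z j.succ := fun h =>
    absurd (z_injective h) (Fin.castSucc_lt_succ).ne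
  have h1 := z_ne_zero (F := F) j.castSucc
  have h2 := z_ne_zero (F := F) j.succ
  have hq := cst_ne_zero (n := n) p.q_ne
  have h3 := cst_mul_z_ne_z (p.q ^ 2) (Fin.castSucc_lt_succ (i := j)).ne
  have h4 := sub_ne_zero.mpr hne.symm
  have heq := congrFun (h.2.1 j) ε
  simp only [Rcheck, smul_one_add_smul_mulVec] at heq
  have h5 := sub_ne_zero.mpr h3
  simp only [cst, map_pow, map_inv₀] at hq h5 heq
  refine demazureLusztig_eq_of_sub p.q_ne
    (d := (z j.succ / z j.castSucc - 1) / (cst p.q - cst p.q⁻¹ * (z j.succ / z j.castSucc))) ?_ ?_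
  · simp only [cst, map_pow, map_inv₀]
    generalize algebraMap F (RatFun F n) p.q = t at *
    generalize (z j.castSucc : RatFun F n) = x at *
    generalize (z j.succ : RatFun F n) = y at *
    have h7 : (1 - x * y⁻¹) = (y - x) / y := by field_simp
    have h8 : t - t⁻¹ * (y / x) = (t ^ 2 * x - y) / (t * x) := by field_simp
    rw [h7, h8]
    field_simp
    ring
  · rw [heq]
    simp only [cst, map_inv₀]
    generalize (ext (e p j) *ᵥ Φ) ε = g
    generalize algebraMap F (RatFun F n) p.q = t at *
    generalize (z j.castSucc : RatFun F n) = x at *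
    generalize (z j.succ : RatFun F n) = y at *
    have h8 : t - t⁻¹ * (y / x) = (t ^ 2 * x - y) / (t * x) := by field_simp
    rw [h8]
    field_simp
    ring

theorem hatTN_of_qkz (h : IsQKZSolution p Φ) (ε : Str n) :
    hatTN p (Φ ε) = (ext (eN p) *ᵥ Φ) ε + cst p.qN⁻¹ * Φ ε := by
  have h3 : (1 : RatFun F n) - z (Fin.last n) ^ 2 ≠ 0 := by
    have ha := one_add_cst_mul_z_ne_zero (one_ne_zero (α := F)) (Fin.last n)
    have hb := one_sub_cst_mul_z_ne_zero (one_ne_zero (α := F)) (Fin.last n)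
    convert mul_ne_zero ha hb using 1
    simp only [cst, map_one]
    ring
  have heq := congrFun h.2.2 ε
  simp only [KN, smul_one_add_smul_mulVec] at heq
  exact demazureLusztig_eq_of_boundary p.qN_ne p.ζN_ne
    (one_add_cst_mul_z_ne_zero (mul_ne_zero p.qN_ne p.ζN_ne) _)
    (one_sub_cst_mul_z_ne_zero (mul_ne_zero p.qN_ne (inv_ne_zero p.ζN_ne)) _) h3 rfl heq

theorem hatT0_of_qkz (h : IsQKZSolution p Φ) (ε : Str n) :
    hatT0 p (Φ ε) = (ext (e0 p) *ᵥ Φ) ε + cst p.q0⁻¹ * Φ ε := by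
  -- K_0(x) depends on x only through x⁻¹, which is therefore the y of the boundary lemma.
  have hx : (cst p.s⁻¹ * z 0 : RatFun F n)⁻¹ = cst p.s * (z 0)⁻¹ := by
    simp [cst, mul_comm]
  have h1 := one_add_cst_mul_z_inv_ne_zero (n := n) (p.q0 * p.ζ0 * p.s) 0
  have h2 := one_sub_cst_mul_z_inv_ne_zero (n := n) (p.q0 * p.ζ0⁻¹ * p.s) 0
  have h3 : (1 : RatFun F n) - (cst p.s * (z 0)⁻¹) ^ 2 ≠ 0 := by
    have ha := one_add_cst_mul_z_inv_ne_zero (n := n) p.s 0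
    have hb := one_sub_cst_mul_z_inv_ne_zero (n := n) p.s 0
    convert mul_ne_zero ha hb using 1
    ring
  rw [cst, map_mul, mul_assoc] at h1 h2
  have heq := congrFun h.1 ε
  simp only [K0, smul_one_add_smul_mulVec, hx] at heq
  refine demazureLusztig_eq_of_boundary p.q0_ne p.ζ0_ne h1 h2 h3 ?_ heq
  simp only [cst, map_mul, map_pow]
  ring

/-! ### The action on the components with at most one up arrow -/

theorem hatT_b0 (h : IsQKZSolution p Φ) (j : Fin n) : hatT p j (Φ b0) = p.q⁻¹ • Φ b0 := by
  rw [hatT_of_qkz h, ext_e_mulVec_b0, zero_add, Algebra.smul_def]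

theorem hatTUnit_inv_b0 (h : IsQKZSolution p Φ) (j : Fin n) :
    (((hatTUnit p j)⁻¹ : (Module.End F (RatFun F n))ˣ) : Module.End F (RatFun F n)) (Φ b0)
      = p.q • Φ b0 := by
  change (hatT p j + (p.q - p.q⁻¹) • 1 : Module.End F (RatFun F n)) (Φ b0) = _
  rw [LinearMap.add_apply, hatT_b0 h, LinearMap.smul_apply, Module.End.one_apply, ← add_smul]
  congr 1
  ring

/-- The added q⁻¹ cancels the diagonal entry -q⁻¹ of e_i at `+-`, leaving a pure shift. The same
cancellation of diagonal entries occurs at the two boundaries. -/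
theorem hatT_upAt (h : IsQKZSolution p Φ) (j : Fin n) :
    hatT p j (Φ (upAt j.castSucc)) = Φ (upAt j.succ) := by
  rw [hatT_of_qkz h, ext_e_mulVec_upAt]
  ring

theorem hatT0_b0 (h : IsQKZSolution p Φ) : hatT0 p (Φ b0) = p.κ0 • Φ (upAt 0) := by
  rw [hatT0_of_qkz h, e0, ext_oneSite_mulVec (ε := b0) _ _ _ (fun _ _ => rfl), Algebra.smul_def]
  simp [b0]

theorem hatTN_upAt (h : IsQKZSolution p Φ) :
    hatTN p (Φ (upAt (Fin.last n))) = p.κN • Φ b0 := by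
  rw [hatTN_of_qkz h, eN, ext_oneSite_mulVec _ _ _ (fun _ hk => upAt_of_ne hk),
    Algebra.smul_def, upAt_self]
  simp

/-! ### Products of operators along the chain and the eigenvalue of Ŷ_i -/

theorem prod_map_apply_of_eigenvector {R M ι : Type*} [CommSemiring R] [AddCommMonoid M]
    [Module R M] {T : ι → Module.End R M} {c : R} {x : M} (h : ∀ i, T i x = c • x) (l : List ι) :
    (l.map T).prod x = c ^ l.length • x := by
  induction l with
  | nil => simp
  | cons i l ih => simp [ih, h, pow_succ, mul_smul]

/-- Successive operators that move `x k` to `x (k + 1)` move `x 0` to the last vector. -/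
theorem prod_reverse_finRange_apply {R M : Type*} [CommSemiring R] [AddCommMonoid M] [Module R M] :
    ∀ {n : ℕ} {T : Fin n → Module.End R M} {x : Fin (n + 1) → M},
      (∀ j, T j (x j.castSucc) = x j.succ) →
        ((List.finRange n).reverse.map T).prod (x 0) = x (Fin.last n)
  | 0, _, _, _ => by simp
  | n + 1, T, x, h => by
    -- In the reversed product `T 0` is the rightmost factor and acts first; the rest is the same
    -- chain shifted by one.
    have ih := prod_reverse_finRange_apply (T := fun j => T j.succ) (x := fun j => x j.succ)
      (fun j => h j.succ)
    have h0 := h 0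
    simp only [Fin.castSucc_zero] at h0
    rw [List.finRange_succ, List.reverse_cons, List.map_append, List.prod_append, List.map_cons,
      List.map_nil, List.prod_singleton, Module.End.mul_apply, h0, ← List.map_reverse,
      List.map_map]
    exact ih

theorem length_filter_finRange_lt (i : Fin (n + 1)) :
    ((List.finRange n).filter fun j => j.val < i.val).length = i := by
  have h : ∀ k m : ℕ, ((List.range k).filter fun j => j < m).length = min m k := by
    intro k m
    induction k with
    | zero => simp
    | succ k ih =>
      rw [List.range_succ, List.filter_append, List.length_append, ih]
      by_cases hm : k < m
      · simp [hm]; omega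
      · simp [hm]; omega
  have h2 := h n i.val
  rw [← List.map_coe_finRange_eq_range, List.filter_map, List.length_map] at h2
  rw [min_eq_left (by omega)] at h2
  exact h2

theorem length_filter_finRange_le (i : Fin (n + 1)) :
    ((List.finRange n).filter fun j => i.val ≤ j.val).length = n - i := by
  have h := List.length_eq_length_filter_add (l := List.finRange n)
    (fun j => decide (j.val < i.val))
  rw [length_filter_finRange_lt, List.length_finRange] at h
  simp only [← decide_not, not_lt] at h
  omega

theorem hatY_b0 (h : IsQKZSolution p Φ) (i : Fin (n + 1)) :
    hatY p i (Φ b0) = (p.κ0 * p.κN * p.q ^ (-((n : ℤ) + 1) + 2 * ((i : ℤ) + 1) - 1)) • Φ b0 := by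
  have hi : (i : ℕ) ≤ n := by omega
  simp only [hatY, Module.End.mul_apply]
  rw [prod_map_apply_of_eigenvector (hatTUnit_inv_b0 h), length_filter_finRange_lt]
  simp only [map_smul, hatT0_b0 h]
  rw [prod_reverse_finRange_apply (x := fun k => Φ (upAt k)) (hatT_upAt h), hatTN_upAt h,
    map_smul, prod_map_apply_of_eigenvector (hatT_b0 h), length_filter_finRange_le, smul_smul,
    smul_smul, smul_smul]
  congr 1
  -- With sites counted from 0 there are i inverse factors and n - i leftmost bulk factors, hence
  -- the exponent i - (n - i).
  rw [inv_pow, ← zpow_natCast, ← zpow_natCast, ← zpow_neg, Nat.cast_sub hi,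
    show -((n : ℤ) + 1) + 2 * ((i : ℤ) + 1) - 1 = i + -(n - i) by ring, zpow_add₀ p.q_ne]
  ring

end Aux

end BoundaryQKZ

theorem mainTheorem5 {F : Type*} [Field F] (n : ℕ) (p : BoundaryQKZ.Params F)
    (X : BoundaryQKZ.KLType) (hX : X.Compatible p)
    (Ψ : BoundaryQKZ.Str n → BoundaryQKZ.RatFun F n)
    (hΨ : BoundaryQKZ.IsQKZSolution p (BoundaryQKZ.klVector p X Ψ)) :
    ∀ i : Fin (n + 1),
      BoundaryQKZ.hatY p i (Ψ BoundaryQKZ.b0) =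
        (p.κ0 * p.κN * p.q ^ (-((n : ℤ) + 1) + 2 * ((i : ℤ) + 1) - 1)) • Ψ BoundaryQKZ.b0 := by
  intro i
  rw [← BoundaryQKZ.klVector_b0 p X Ψ]
  exact BoundaryQKZ.hatY_b0 hΨ i
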